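/- Let $\mathcal G$ be the star graph made of three half-lines $\mathbb R^+=(0,\infty)$ with a common origin (the vertex). Let $L^2(\mathcal G)=\bigoplus_{i=1}^3L^2(\mathbb R^+)$ (complex-valued functions), with $\|\Psi\|^2=\sum_{i=1}^3\|\Psi_i\|_{L^2(\mathbb R^+)}^2$. Call $\Psi=(\Psi_1,\Psi_2,\Psi_3)\in L^2(\mathcal G)$ admissible if $\Psi_i\in H^1(\mathbb R^+)$ for $i=1,2,3$ and $\Psi$ is continuous at the vertex, i.e. $\Psi_1(0)=\Psi_2(0)=\Psi_3(0)$ (the form domain of the Laplacian with Kirchhoff vertex). The cubic focusing NLS energy of an admissible state is $$E(\Psi)=\sum_{i=1}^3\left(\tfrac12\|\Psi_i'\|_{L^2(\mathbb R^+)}^2-\tfrac14\|\Psi_i\|_{L^4(\mathbb R^+)}^4\right).$$ A sesquisoliton is a function of the form $$\Phi_{m_1,m_2}^{x}(x_1,x_2,x_3)=\left(\frac{m_1}{\sqrt2\,\cosh\left(\frac{m_1}{2}x_1\right)},\ \frac{m_2}{2\sqrt2\,\cosh\left(\frac{m_2}{4}(x_2-x)\right)},\ \frac{m_2}{2\sqrt2\,\cosh\left(\frac{m_2}{4}(x_3+x)\right)}\right),$$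 where $0<m_1\le m_2$, $x\ge0$, and $m_1=\dfrac{m_2}{2\cosh\left(\frac{m_2}{4}x\right)}$ (continuity at the vertex). For $M>0$ let $\mathcal S_M$ be the set of all sesquisolitons $\Phi_{m_1,m_2}^{x}$ with $\|\Phi_{m_1,m_2}^{x}\|^2=M$. **Theorem 1.** Let $M>0$. Then $$\inf\{E(\Psi):\Psi\text{ admissible},\ \|\Psi\|^2=M\}=\inf_{\Psi\in\mathcal S_M}E(\Psi)=-\frac{M^3}{96},$$ and $E(\Psi)>-\dfrac{M^3}{96}$ for every admissible $\Psi$ with $\|\Psi\|^2=M$. Thus the infimum is not attained, and there is no ground state of mass $M$. -/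

import Mathlib

open MeasureTheory Set
open scoped ContDiff

namespace StarGraph

noncomputable section

/-- Lebesgue measure on an edge, that is, on the open half-line `(0, ∞)`. -/
abbrev halfLine : Measure ℝ := volume.restrict (Ioi 0)

/-- The complex Hilbert space `L²(ℝ⁺)`. -/
abbrev L2Edge : Type := Lp ℂ 2 halfLine

/-- The complex Hilbert space `L²(𝒢)` of the three-edge star graph: the Hilbert sum of three copies
of `L²(ℝ⁺)`, with `‖Ψ‖² = ∑ᵢ ‖Ψᵢ‖²`. -/
abbrev L2Graph : Type := PiLp 2 (fun _ : Fin 3 => L2Edge)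

/-- `v` is the weak derivative of `u` on `(0, ∞)`: integration by parts holds against every smooth
test function with compact support in `(0, ∞)`. -/
def IsWeakDeriv (u v : L2Edge) : Prop :=
  ∀ φ : ℝ → ℝ, ContDiff ℝ ∞ φ → HasCompactSupport φ → tsupport φ ⊆ Ioi 0 →
    ∫ x, deriv φ x • u x ∂halfLine = - ∫ x, φ x • v x ∂halfLine

/-- The Sobolev space `H¹(ℝ⁺)`: square-integrable functions with a square-integrable weak
derivative. -/
def H1Edge : Set L2Edge := {u | ∃ v : L2Edge, IsWeakDeriv u v}

/-- The weak derivative is unique. -/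
theorem IsWeakDeriv.unique {u v w : L2Edge} (hv : IsWeakDeriv u v) (hw : IsWeakDeriv u w) :
    v = w := by
  have hloc : ∀ f : L2Edge, LocallyIntegrableOn (fun x => f x) (Ioi (0 : ℝ)) volume := by
    intro f
    have h2 : LocallyIntegrable (fun x => f x) (volume.restrict (Ioi (0 : ℝ))) :=
      (Lp.memLp f).locallyIntegrable (by norm_num)
    exact locallyIntegrableOn_of_locallyIntegrable_restrict h2
  have hprod : ∀ (f : L2Edge) (φ : ℝ → ℝ), Continuous φ → HasCompactSupport φ →
      Integrable (fun x => φ x • f x) halfLine := fun f φ hc hs =>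
    ((Lp.memLp f).locallyIntegrable (by norm_num)).integrable_smul_left_of_hasCompactSupport hc hs
  have key : ∀ᵐ x, x ∈ Ioi (0 : ℝ) → v x - w x = 0 := by
    refine isOpen_Ioi.ae_eq_zero_of_integral_contDiff_smul_eq_zero
      ((hloc v).sub (hloc w)) fun φ h1 h2 h3 => ?_
    have h4 : ∫ x, φ x • (v x - w x) ∂halfLine = 0 := by
      have e1 := hv φ h1 h2 h3
      have e2 := hw φ h1 h2 h3
      simp only [smul_sub]
      rw [integral_sub (hprod v φ h1.continuous h2) (hprod w φ h1.continuous h2),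
        sub_eq_zero, ← neg_inj, ← e1, ← e2]
    rw [← h4]
    refine (setIntegral_eq_integral_of_forall_compl_eq_zero fun x hx => ?_).symm
    rw [image_eq_zero_of_notMem_tsupport fun h => hx (h3 h), zero_smul]
  refine Lp.ext ?_
  have h5 := (ae_restrict_iff' measurableSet_Ioi).2 key
  filter_upwards [h5] with x hx using sub_eq_zero.1 hx

open Classical in
/-- The weak derivative of a function in `H¹(ℝ⁺)` (and `0`, by convention, outside
`H¹(ℝ⁺)`). -/
def weakDeriv (u : L2Edge) : L2Edge :=
  if h : ∃ v : L2Edge, IsWeakDeriv u v then h.choose else 0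

/-- The defining property of the weak derivative. -/
theorem IsWeakDeriv.weakDeriv_eq {u v : L2Edge} (hv : IsWeakDeriv u v) : weakDeriv u = v := by
  have h : ∃ v : L2Edge, IsWeakDeriv u v := ⟨v, hv⟩
  rw [weakDeriv, dif_pos h]
  exact h.choose_spec.unique hv

/-- `a` is the value at the vertex of `u`: the representative of `u` that is continuous on `[0, ∞)`
takes the value `a` at `0`. -/
def HasVertexValue (u : L2Edge) (a : ℂ) : Prop :=
  ∃ g : ℝ → ℂ, ContinuousOn g (Ici 0) ∧ u =ᵐ[halfLine] g ∧ g 0 = a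

/-- The energy space for the Kirchhoff vertex (the form domain of the Kirchhoff Laplacian): all
`Ψ ∈ H¹(𝒢) = ⊕ᵢ H¹(ℝ⁺)` that are continuous at the vertex, `Ψ₁(0) = Ψ₂(0) = Ψ₃(0)`. -/
def energySpace : Set L2Graph :=
  {Ψ | (∀ i, Ψ i ∈ H1Edge) ∧ ∃ a : ℂ, ∀ i, HasVertexValue (Ψ i) a}

/-- The admissible states of mass `M`: the `Ψ` in the energy space with `‖Ψ‖² = M`. -/
def massSphere (M : ℝ) : Set L2Graph := {Ψ | Ψ ∈ energySpace ∧ ‖Ψ‖ ^ 2 = M}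

/-- The cubic focusing NLS energy
`E(Ψ) = ∑ᵢ (1/2 ‖Ψᵢ'‖²_{L²(ℝ⁺)} - 1/4 ‖Ψᵢ‖⁴_{L⁴(ℝ⁺)})`. -/
def energy (Ψ : L2Graph) : ℝ :=
  ∑ i, ((1 / 2) * ‖weakDeriv (Ψ i)‖ ^ 2 - (1 / 4) * ∫ x, ‖Ψ i x‖ ^ 4 ∂halfLine)

/-- The profile of the function with parameters `m₁`, `m₂`, `x` on each of the three edges; here
`cosh⁻¹ = 1 / cosh`. -/
def profile (m₁ m₂ x : ℝ) : Fin 3 → ℝ → ℝ :=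
  ![fun t => m₁ / √2 * (Real.cosh (m₁ / 2 * t))⁻¹,
    fun t => m₂ / (2 * √2) * (Real.cosh (m₂ / 4 * (t - x)))⁻¹,
    fun t => m₂ / (2 * √2) * (Real.cosh (m₂ / 4 * (t + x)))⁻¹]

/-- `Ψ` is the sesquisoliton with parameters `m₁`, `m₂`, `x`, where `0 < m₁ ≤ m₂`, `0 ≤ x`, and the
condition of continuity at the vertex holds. -/
def IsSesquisoliton (m₁ m₂ x : ℝ) (Ψ : L2Graph) : Prop :=
  0 < m₁ ∧ m₁ ≤ m₂ ∧ 0 ≤ x ∧ m₁ = m₂ / 2 * (Real.cosh (m₂ / 4 * x))⁻¹ ∧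
    ∀ i, Ψ i =ᵐ[halfLine] fun t => (profile m₁ m₂ x i t : ℂ)

/-- The set `𝒮_M` of the sesquisolitons of mass `M`. -/
def sesquisolitons (M : ℝ) : Set L2Graph :=
  {Ψ | (∃ m₁ m₂ x : ℝ, IsSesquisoliton m₁ m₂ x Ψ) ∧ ‖Ψ‖ ^ 2 = M}

end

end StarGraph

/-! The lower bound is a Modica–Mortola argument. Given an admissible state, let `2 * κ` be the
supremum of `|ψ|²` over the whole graph, let `w` be the nonnegative root of `κ|ψ|² - |ψ|⁴/2`, and
let `P = potential κ`. Completing the square (`edge_action_eq`) turns the energy plus `κ/2` times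
the mass into half the integral of `(|ψ'| - w)²` plus the integral of `w|ψ'|`. The latter dominates
the variation of `P(|ψ|²)` along the edges (`two_mul_potential_le`).

If `a` is the vertex value, an edge on which `|ψ|²` takes the value `n` contributes at least `2P(n)
- P(|a|²)`, since `ψ` is small in mean square far out, and each of the other two contributes at
least `P(|a|²)`. The total is at least `2P(n) + P(|a|²)`. As `n` approaches `2 * κ` and with `t =
√κ`, the energy is at least `4/3 t³ - M t²/2 + P(|a|²)`. The cubic has minimum `-M³/96` on `t ≥ 0`,
at `t = M/4`.

Equality would force `P(|a|²) = 0`, hence `a = 0`, and `|ψ'| = w ≤ √κ |ψ|` almost everywhere. By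
Gronwall (`eq_zero_of_norm_weakDeriv_le`) the state would vanish, contradicting positive mass.

The bound is sharp because a sesquisoliton has mass `m₁ + m₂` and energy `-m₁³/24 - m₂³/96`: its
second and third edges together carry one full line soliton. With the mass fixed, letting `m₁` tend
to `0` gives `-M³/96`. -/

namespace StarGraph

/-! ### Weak derivatives and continuous representatives on the half-line -/

/-- The primitive of a smooth function with compact support in `(0, ∞)` and vanishing integral is
again a test function. -/
theorem exists_testFunction_deriv_eq {ζ : ℝ → ℝ} (hζ : ContDiff ℝ ∞ ζ) {α β : ℝ} (hα : 0 < α)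
    (hsupp : Function.support ζ ⊆ Icc α β) (hint : ∫ x, ζ x = 0) :
    ∃ φ : ℝ → ℝ, ContDiff ℝ ∞ φ ∧ HasCompactSupport φ ∧ tsupport φ ⊆ Ioi 0 ∧ deriv φ = ζ := by
  have hd : ∀ x, HasDerivAt (fun x => ∫ t in (0 : ℝ)..x, ζ t) (ζ x) x := fun x =>
    intervalIntegral.integral_hasDerivAt_right (hζ.continuous.intervalIntegrable _ _)
      (hζ.continuous.stronglyMeasurableAtFilter _ _) hζ.continuous.continuousAt
  have hderiv : deriv (fun x => ∫ t in (0 : ℝ)..x, ζ t) = ζ := funext fun x => (hd x).deriv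
  have hzero : ∀ x, x ∉ Icc α β → ∫ t in (0 : ℝ)..x, ζ t = 0 := by
    intro x hx
    rcases lt_or_ge x α with h | h
    · refine intervalIntegral.integral_zero_ae (Filter.Eventually.of_forall fun t ht => ?_)
      by_contra hne
      have h1 := (hsupp hne).1
      rw [mem_uIoc] at ht
      rcases ht with ht | ht <;> linarith [ht.1, ht.2]
    · have hβ : β < x := by
        by_contra hc
        exact hx ⟨h, not_lt.1 hc⟩
      -- Beyond `β` the primitive has already collected the whole integral, which is zero.
      rw [intervalIntegral.integral_eq_integral_of_support_subset, hint]
      exact fun t ht => ⟨hα.trans_le (hsupp ht).1, (hsupp ht).2.trans hβ.le⟩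
  have hsub : tsupport (fun x => ∫ t in (0 : ℝ)..x, ζ t) ⊆ Icc α β :=
    closure_minimal (fun x hx => by_contra fun hc => hx (hzero x hc)) isClosed_Icc
  refine ⟨_, ?_, isCompact_Icc.of_isClosed_subset (isClosed_tsupport _) hsub,
    fun x hx => hα.trans_le (hsub hx).1, hderiv⟩
  rw [contDiff_infty_iff_deriv, hderiv]
  exact ⟨fun x => (hd x).differentiableAt, hζ⟩

/-- The lemma of du Bois-Reymond on the half-line. -/
theorem ae_eq_const_of_integral_deriv_mul_eq_zero {f : ℝ → ℝ}
    (hf : LocallyIntegrable f halfLine)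
    (h : ∀ φ : ℝ → ℝ, ContDiff ℝ ∞ φ → HasCompactSupport φ → tsupport φ ⊆ Ioi 0 →
      ∫ x, deriv φ x * f x ∂halfLine = 0) :
    ∃ c, f =ᵐ[halfLine] fun _ => c := by
  -- A fixed bump of integral one supported in `[1, 3]`, away from the vertex; its pairing with `f`
  -- is the constant sought.
  let b : ContDiffBump (2 : ℝ) := ⟨1 / 2, 1, by norm_num, by norm_num⟩
  set η₀ : ℝ → ℝ := b.normed volume with hη₀
  have s₀ : ContDiff ℝ ∞ η₀ := b.contDiff_normed
  have c₀ : HasCompactSupport η₀ := b.hasCompactSupport_normed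
  have t₀ : tsupport η₀ = Icc 1 3 := by
    rw [hη₀, b.tsupport_normed_eq, Real.closedBall_eq_Icc]; norm_num [b]
  have i₀ : ∫ x, η₀ x = 1 := b.integral_normed
  have hmul : ∀ η : ℝ → ℝ, ContDiff ℝ ∞ η → HasCompactSupport η →
      Integrable (fun x => η x * f x) halfLine := fun η h1 h2 =>
    hf.integrable_smul_left_of_hasCompactSupport h1.continuous h2
  refine ⟨∫ x, η₀ x * f x ∂halfLine, ?_⟩
  set c := ∫ x, η₀ x * f x ∂halfLine with hc
  have key : ∀ᵐ x, x ∈ Ioi (0 : ℝ) → f x - c = 0 := by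
    refine isOpen_Ioi.ae_eq_zero_of_integral_contDiff_smul_eq_zero
      ((locallyIntegrableOn_of_locallyIntegrable_restrict hf).sub
        ((locallyIntegrable_const c).locallyIntegrableOn _)) fun η h1 h2 h3 => ?_
    have hK : IsCompact (tsupport η ∪ tsupport η₀) := h2.isCompact.union c₀.isCompact
    have hne : (tsupport η ∪ tsupport η₀).Nonempty := ⟨2, Or.inr (by rw [t₀]; norm_num)⟩
    obtain ⟨α, hα⟩ := hK.exists_isLeast hne
    obtain ⟨β, hβ⟩ := hK.exists_isGreatest hne
    have hα0 : 0 < α := by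
      rcases hα.1 with h | h
      · exact h3 h
      · rw [t₀] at h; linarith [h.1]
    set I := ∫ x, η x with hI
    have iη : Integrable η := h1.continuous.integrable_of_hasCompactSupport h2
    have iη₀ : Integrable η₀ := s₀.continuous.integrable_of_hasCompactSupport c₀
    -- Subtracting `I * η₀` removes the mean of `η`, so that the difference is the derivative of a
    -- test function.
    obtain ⟨φ, p1, p2, p3, p4⟩ := exists_testFunction_deriv_eq (ζ := fun x => η x - I * η₀ x)
      (h1.sub (contDiff_const.mul s₀)) hα0 (β := β) (by
        intro x hx
        have : x ∈ tsupport η ∪ tsupport η₀ := by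
          by_contra hcon
          rw [mem_union, not_or] at hcon
          exact hx (by simp [image_eq_zero_of_notMem_tsupport hcon.1,
            image_eq_zero_of_notMem_tsupport hcon.2])
        exact ⟨hα.2 this, hβ.2 this⟩) (by
        rw [integral_sub iη (iη₀.const_mul I), integral_const_mul, i₀]; simp [hI])
    have h4 := h φ p1 p2 p3
    rw [p4] at h4
    have h5 : ∫ x, η x * f x ∂halfLine = I * c := by
      have e : ∀ x, (η x - I * η₀ x) * f x = η x * f x - I * (η₀ x * f x) := fun x => by ring
      simp only [e] at h4
      rw [integral_sub (hmul η h1 h2) ((hmul η₀ s₀ c₀).const_mul I), integral_const_mul] at h4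
      linarith
    have off : ∀ x, x ∉ Ioi (0 : ℝ) → η x = 0 := fun x hx =>
      image_eq_zero_of_notMem_tsupport fun h => hx (h3 h)
    have h6 : ∫ x, η x ∂halfLine = I :=
      setIntegral_eq_integral_of_forall_compl_eq_zero off
    have h7 : ∫ x, η x • (f x - c) ∂halfLine = 0 := by
      simp only [smul_eq_mul, mul_sub]
      rw [integral_sub (hmul η h1 h2) (iη.restrict.mul_const c), integral_mul_const, h5, h6, sub_self]
    rw [← h7]
    exact (setIntegral_eq_integral_of_forall_compl_eq_zero fun x hx => by simp [off x hx]).symm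
  filter_upwards [(ae_restrict_iff' measurableSet_Ioi).2 key] with x hx using sub_eq_zero.1 hx

/-- Two functions that are continuous on `[0, ∞)` and agree almost everywhere on `(0, ∞)` agree on
`[0, ∞)`. -/
theorem eqOn_Ici_of_ae_eq {f g : ℝ → ℂ} (hf : ContinuousOn f (Ici 0)) (hg : ContinuousOn g (Ici 0))
    (h : f =ᵐ[halfLine] g) : EqOn f g (Ici 0) := by
  have h1 : EqOn f g (Ioi 0) :=
    Measure.eqOn_open_of_ae_eq h isOpen_Ioi (hf.mono Ioi_subset_Ici_self)
      (hg.mono Ioi_subset_Ici_self)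
  exact h1.of_subset_closure hf hg Ioi_subset_Ici_self (by rw [closure_Ioi])

/-- Local integrability for the restricted measure is required at every point of `ℝ`, including `0`,
so integrability holds up to the vertex. -/
theorem intervalIntegrable_of_locallyIntegrable_halfLine {g : ℝ → ℝ}
    (hg : LocallyIntegrable g halfLine) {x y : ℝ} (hx : 0 ≤ x) (hy : 0 ≤ y) :
    IntervalIntegrable g volume x y := by
  have h := hg.integrableOn_isCompact (isCompact_uIcc (a := x) (b := y))
  rw [IntegrableOn, Measure.restrict_restrict measurableSet_uIcc] at h
  rw [intervalIntegrable_iff]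
  refine IntegrableOn.mono_set h fun t ht => ⟨uIoc_subset_uIcc ht, ?_⟩
  rw [mem_uIoc] at ht
  rcases ht with ht | ht
  · exact hx.trans_lt ht.1
  · exact hy.trans_lt ht.1

theorem absolutelyContinuousOnInterval_primitive {g : ℝ → ℝ} (hg : LocallyIntegrable g halfLine)
    (c : ℝ) {b : ℝ} (hb : 0 ≤ b) :
    AbsolutelyContinuousOnInterval (fun x => c + ∫ t in (0 : ℝ)..x, g t) 0 b := by
  have h1 : AbsolutelyContinuousOnInterval (fun _ : ℝ => c) 0 b :=
    (contDiff_const (n := 1)).contDiffOn.absolutelyContinuousOnInterval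
  exact h1.fun_add ((intervalIntegrable_of_locallyIntegrable_halfLine hg
    le_rfl hb).absolutelyContinuousOnInterval_intervalIntegral left_mem_uIcc)

theorem ae_hasDerivAt_primitive {g : ℝ → ℝ} (hg : LocallyIntegrable g halfLine)
    (c : ℝ) {b : ℝ} (hb : 0 ≤ b) :
    ∀ᵐ x, x ∈ uIcc 0 b → HasDerivAt (fun x => c + ∫ t in (0 : ℝ)..x, g t) (g x) x := by
  filter_upwards [(intervalIntegrable_of_locallyIntegrable_halfLine hg
    le_rfl hb).ae_hasDerivAt_integral] with x hx h
  exact (hx h 0 left_mem_uIcc).const_add c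

theorem continuousOn_primitive {g : ℝ → ℝ} (hg : LocallyIntegrable g halfLine) (c : ℝ) :
    ContinuousOn (fun x => c + ∫ t in (0 : ℝ)..x, g t) (Ici 0) := by
  intro x hx
  have h1 := (absolutelyContinuousOnInterval_primitive hg c (b := x + 1)
    (by linarith [mem_Ici.1 hx])).continuousOn
  rw [uIcc_of_le (by linarith [mem_Ici.1 hx])] at h1
  refine (h1 x ⟨hx, by linarith⟩).mono_of_mem_nhdsWithin ?_
  rw [← Ici_inter_Iic]
  exact inter_mem_nhdsWithin _ (Iic_mem_nhds (by linarith))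

/-- A locally integrable function with locally integrable weak derivative is a primitive of its
weak derivative. -/
theorem ae_eq_primitive_of_weakDeriv {f g : ℝ → ℝ} (hf : LocallyIntegrable f halfLine)
    (hg : LocallyIntegrable g halfLine)
    (h : ∀ φ : ℝ → ℝ, ContDiff ℝ ∞ φ → HasCompactSupport φ → tsupport φ ⊆ Ioi 0 →
      ∫ x, deriv φ x * f x ∂halfLine = - ∫ x, φ x * g x ∂halfLine) :
    ∃ c, f =ᵐ[halfLine] fun x => c + ∫ t in (0 : ℝ)..x, g t := by
  set G : ℝ → ℝ := fun x => 0 + ∫ t in (0 : ℝ)..x, g t with hG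
  have hGl : LocallyIntegrable G halfLine := by
    intro x
    refine ⟨Iic (|x| + 1), Iic_mem_nhds (by linarith [le_abs_self x]), ?_⟩
    rw [IntegrableOn, Measure.restrict_restrict measurableSet_Iic, Iic_inter_Ioi]
    refine IntegrableOn.mono_set (t := Icc 0 (|x| + 1)) ?_ Ioc_subset_Icc_self
    exact ((continuousOn_primitive hg 0).mono Icc_subset_Ici_self).integrableOn_compact
      isCompact_Icc
  obtain ⟨c, hc⟩ := ae_eq_const_of_integral_deriv_mul_eq_zero (f := fun x => f x - G x)
    (hf.sub hGl) (by
    intro φ h1 h2 h3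
    have hφ' : ContDiff ℝ ∞ (deriv φ) := (contDiff_infty_iff_deriv.1 h1).2
    have i1 : Integrable (fun x => deriv φ x * f x) halfLine :=
      hf.integrable_smul_left_of_hasCompactSupport hφ'.continuous h2.deriv
    have i2 : Integrable (fun x => deriv φ x * G x) halfLine :=
      hGl.integrable_smul_left_of_hasCompactSupport hφ'.continuous h2.deriv
    simp only [mul_sub]
    rw [integral_sub i1 i2, h φ h1 h2 h3]
    -- Integration by parts takes place on `[0, b]` with `b` bounding the support of `φ`; both
    -- boundary terms vanish.
    obtain ⟨β, hβ⟩ := h2.isCompact.bddAbove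
    set b := max β 0 with hb
    have hb0 : 0 ≤ b := le_max_right _ _
    have off : ∀ x, b < x → x ∉ tsupport φ := fun x hx hm =>
      absurd (hβ hm) (not_le.2 ((le_max_left _ _).trans_lt hx))
    have off' : ∀ x, x ∉ Ioc 0 b → x ∉ tsupport φ := by
      intro x hx hm
      exact hx ⟨h3 hm, not_lt.1 fun hc => off x hc hm⟩
    have toInt : ∀ k : ℝ → ℝ, (∀ x, x ∉ tsupport φ → k x = 0) →
        ∫ x, k x ∂halfLine = ∫ x in (0 : ℝ)..b, k x := by
      intro k hk
      rw [intervalIntegral.integral_of_le hb0,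
        setIntegral_eq_integral_of_forall_compl_eq_zero fun x hx => hk x fun hm => hx (h3 hm),
        setIntegral_eq_integral_of_forall_compl_eq_zero fun x hx => hk x (off' x hx)]
    have hd0 : ∀ x, x ∉ tsupport φ → deriv φ x = 0 := fun x hx =>
      image_eq_zero_of_notMem_tsupport fun hm => hx (tsupport_deriv_subset hm)
    rw [toInt _ fun x hx => by rw [image_eq_zero_of_notMem_tsupport hx, zero_mul],
      toInt _ fun x hx => by rw [hd0 x hx, zero_mul]]
    have acφ : AbsolutelyContinuousOnInterval φ 0 b :=
      (h1.of_le (by exact_mod_cast le_top)).contDiffOn.absolutelyContinuousOnInterval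
    have acG := absolutelyContinuousOnInterval_primitive hg 0 hb0
    have ibp := acφ.integral_mul_deriv_eq_deriv_mul acG
    have e0 : ∫ x in (0 : ℝ)..b, φ x * deriv G x = ∫ x in (0 : ℝ)..b, φ x * g x := by
      refine intervalIntegral.integral_congr_ae ?_
      filter_upwards [ae_hasDerivAt_primitive hg 0 hb0] with x hx hm
      rw [(hx (uIoc_subset_uIcc hm)).deriv]
    have eb : φ b = 0 ∨ b = 0 := by
      by_contra hcon
      rw [not_or] at hcon
      have hpos : 0 < b := lt_of_le_of_ne hb0 (Ne.symm hcon.2)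
      have hev : φ b = 0 := by
        -- The point `b` may lie in the support, so `φ b = 0` follows by continuity from the right,
        -- where `φ` vanishes.
        have hcont := h1.continuous.tendsto b
        have h0 : Filter.Tendsto φ (nhdsWithin b (Ioi b)) (nhds 0) := by
          refine tendsto_const_nhds.congr' ?_
          filter_upwards [self_mem_nhdsWithin] with x hx
          exact (image_eq_zero_of_notMem_tsupport (off x hx)).symm
        exact tendsto_nhds_unique (hcont.mono_left nhdsWithin_le_nhds) h0
      exact hcon.1 hev
    have e00 : φ 0 = 0 := image_eq_zero_of_notMem_tsupport fun hm => lt_irrefl (0 : ℝ) (h3 hm)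
    have ebb : φ b = 0 := by
      rcases eb with h | h
      · exact h
      · rw [h, e00]
    change ∫ x in (0 : ℝ)..b, φ x * deriv G x = _ at ibp
    rw [e0, ebb, e00] at ibp
    rw [ibp]
    change - (0 * _ - 0 * _ - ∫ x in (0 : ℝ)..b, deriv φ x * G x) - _ = _
    ring)
  refine ⟨c, ?_⟩
  filter_upwards [hc] with x hx
  simp only [hG] at hx
  linarith

theorem memLp_re (u : L2Edge) : MemLp (fun x => (u x).re) 2 halfLine := (Lp.memLp u).re
theorem memLp_im (u : L2Edge) : MemLp (fun x => (u x).im) 2 halfLine := (Lp.memLp u).im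

theorem locallyIntegrable_re (u : L2Edge) : LocallyIntegrable (fun x => (u x).re) halfLine :=
  (memLp_re u).locallyIntegrable (by norm_num)

theorem locallyIntegrable_im (u : L2Edge) : LocallyIntegrable (fun x => (u x).im) halfLine :=
  (memLp_im u).locallyIntegrable (by norm_num)

theorem integrable_testFunction_smul (u : L2Edge) {φ : ℝ → ℝ} (h1 : Continuous φ)
    (h2 : HasCompactSupport φ) : Integrable (fun x => φ x • u x) halfLine :=
  ((Lp.memLp u).locallyIntegrable (by norm_num)).integrable_smul_left_of_hasCompactSupport h1 h2

/-- The representative on `[0, ∞)` with value `a` at the vertex and derivative `v`. -/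
noncomputable def primitive (a : ℂ) (v : L2Edge) (x : ℝ) : ℂ :=
  ⟨a.re + ∫ t in (0 : ℝ)..x, (v t).re, a.im + ∫ t in (0 : ℝ)..x, (v t).im⟩

theorem continuousOn_complex_primitive (a : ℂ) (v : L2Edge) :
    ContinuousOn (primitive a v) (Ici 0) := by
  have h : primitive a v = fun x => (((a.re + ∫ t in (0 : ℝ)..x, (v t).re : ℝ) : ℂ) +
      ((a.im + ∫ t in (0 : ℝ)..x, (v t).im : ℝ) : ℂ) * Complex.I) := by
    funext x
    exact Complex.ext (by simp [primitive]) (by simp [primitive])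
  rw [h]
  exact (Complex.continuous_ofReal.comp_continuousOn
    (continuousOn_primitive (locallyIntegrable_re v) a.re)).add
    ((Complex.continuous_ofReal.comp_continuousOn
    (continuousOn_primitive (locallyIntegrable_im v) a.im)).mul continuousOn_const)

theorem primitive_zero (a : ℂ) (v : L2Edge) : primitive a v 0 = a := by
  simp [primitive]

/-- Real and imaginary parts are each primitives up to a constant; comparing continuous
representatives at `0` identifies the constant with the vertex value. -/
theorem IsWeakDeriv.ae_eq_primitive {u v : L2Edge} (hv : IsWeakDeriv u v) {a : ℂ}
    (ha : HasVertexValue u a) : u =ᵐ[halfLine] primitive a v := by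
  obtain ⟨c, hc⟩ := ae_eq_primitive_of_weakDeriv (locallyIntegrable_re u) (locallyIntegrable_re v)
    fun φ h1 h2 h3 => by
      have e := congrArg Complex.re (hv φ h1 h2 h3)
      have i1 := integrable_testFunction_smul u (contDiff_infty_iff_deriv.1 h1).2.continuous h2.deriv
      have i2 := integrable_testFunction_smul v h1.continuous h2
      rw [Complex.neg_re, ← RCLike.re_eq_complex_re, ← integral_re i1, ← integral_re i2] at e
      simpa using e
  obtain ⟨d, hd⟩ := ae_eq_primitive_of_weakDeriv (locallyIntegrable_im u) (locallyIntegrable_im v)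
    fun φ h1 h2 h3 => by
      have e := congrArg Complex.im (hv φ h1 h2 h3)
      have i1 := integrable_testFunction_smul u (contDiff_infty_iff_deriv.1 h1).2.continuous h2.deriv
      have i2 := integrable_testFunction_smul v h1.continuous h2
      rw [Complex.neg_im, ← RCLike.im_eq_complex_im, ← integral_im i1, ← integral_im i2] at e
      simpa using e
  have h : u =ᵐ[halfLine] primitive ⟨c, d⟩ v := by
    filter_upwards [hc, hd] with x h1 h2
    exact Complex.ext h1 h2
  obtain ⟨k, k1, k2, k3⟩ := ha
  have := eqOn_Ici_of_ae_eq k1 (continuousOn_complex_primitive ⟨c, d⟩ v)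
    (k2.symm.trans h) self_mem_Ici
  rw [k3, primitive_zero] at this
  rwa [this]

/-! ### The Modica–Mortola potential -/

/-- `Real.sqrt` is zero on negative numbers, so the formula persists there; at `0` it follows from
continuity of the function and of the candidate derivative. -/
theorem hasDerivAt_mul_sqrt (y : ℝ) : HasDerivAt (fun y => y * √y) (3 / 2 * √y) y := by
  have hne : ∀ y : ℝ, y ≠ 0 → HasDerivAt (fun y => y * √y) (3 / 2 * √y) y := by
    intro y hy
    refine ((hasDerivAt_id y).fun_mul (Real.hasDerivAt_sqrt hy)).congr_deriv ?_
    rcases lt_or_gt_of_ne hy with h1 | h1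
    · simp [Real.sqrt_eq_zero_of_nonpos h1.le]
    · have h2 := Real.sq_sqrt h1.le
      have h3 := (Real.sqrt_pos.2 h1).ne'
      rw [id]
      field_simp
      linarith
  rcases eq_or_ne y 0 with rfl | hy
  · exact hasDerivAt_of_hasDerivAt_of_ne (f := fun y => y * √y) (g := fun y => 3 / 2 * √y)
      (fun y h => hne y h) (by fun_prop) (by fun_prop)
  · exact hne y hy

/-- The primitive of the optimal weight in the Modica–Mortola estimate, as a function of the
density `n = |ψ|²`. -/
noncomputable def potential (κ n : ℝ) : ℝ := 2 / 3 * (κ * √κ - (κ - n / 2) * √(κ - n / 2))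

/-- The factor is chosen so that `2 P'(|z|²) |z|` is exactly `weight κ z`. The truncated square root
makes this valid for all `n`, without a bound by `2 * κ`. -/
theorem hasDerivAt_potential (κ n : ℝ) :
    HasDerivAt (potential κ) (1 / 2 * √(κ - n / 2)) n := by
  have h1 : HasDerivAt (fun n : ℝ => κ - n / 2) (-(1 / 2)) n := by
    simpa using ((hasDerivAt_id n).div_const 2).const_sub κ
  have h2 := (((hasDerivAt_mul_sqrt (κ - n / 2)).comp n h1).const_sub (κ * √κ)).const_mul (2 / 3)
  exact h2.congr_deriv (by ring)

theorem continuous_potential (κ : ℝ) : Continuous (potential κ) := by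
  unfold potential; fun_prop

theorem potential_zero (κ : ℝ) : potential κ 0 = 0 := by simp [potential]

theorem potential_nonneg {κ n : ℝ} (hn : 0 ≤ n) (h : n ≤ 2 * κ) : 0 ≤ potential κ n := by
  unfold potential
  have h1 : 0 ≤ κ - n / 2 := by linarith
  have h2 : κ - n / 2 ≤ κ := by linarith
  have := mul_le_mul h2 (Real.sqrt_le_sqrt h2) (Real.sqrt_nonneg _) (h1.trans h2)
  linarith

theorem potential_pos {κ n : ℝ} (hn : 0 < n) (h : n ≤ 2 * κ) : 0 < potential κ n := by
  unfold potential
  have h1 : 0 ≤ κ - n / 2 := by linarith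
  have h2 : κ - n / 2 < κ := by linarith
  have h3 := mul_le_mul_of_nonneg_left (Real.sqrt_le_sqrt h2.le) h1
  have h4 := mul_lt_mul_of_pos_right h2 (Real.sqrt_pos.2 (h1.trans_lt h2))
  linarith

theorem potential_two_mul (κ : ℝ) : potential κ (2 * κ) = 2 / 3 * (κ * √κ) := by
  simp [potential]

/-! ### Chain rule along an edge, boundedness and decay -/

/-- Lipschitz functions preserve absolute continuity. -/
theorem absolutelyContinuousOnInterval_comp {f g : ℝ → ℝ} {a b : ℝ} {s : Set ℝ} {K : NNReal}
    (hf : AbsolutelyContinuousOnInterval f a b) (hfs : ∀ x ∈ uIcc a b, f x ∈ s)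
    (hg : LipschitzOnWith K g s) : AbsolutelyContinuousOnInterval (fun x => g (f x)) a b := by
  rw [absolutelyContinuousOnInterval_iff] at hf ⊢
  intro ε hε
  -- `K + 1` instead of `K`, since `K` may be zero.
  obtain ⟨δ, hδ, h⟩ := hf (ε / (K + 1)) (by positivity)
  refine ⟨δ, hδ, fun E hE hlt => ?_⟩
  have h1 := h E hE hlt
  have hmem : ∀ i ∈ Finset.range E.1, (E.2 i).1 ∈ uIcc a b ∧ (E.2 i).2 ∈ uIcc a b := hE.1
  calc ∑ i ∈ Finset.range E.1, dist (g (f (E.2 i).1)) (g (f (E.2 i).2))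
      ≤ ∑ i ∈ Finset.range E.1, (K + 1) * dist (f (E.2 i).1) (f (E.2 i).2) := by
        refine Finset.sum_le_sum fun i hi => ?_
        refine (hg.dist_le_mul _ (hfs _ (hmem i hi).1) _ (hfs _ (hmem i hi).2)).trans ?_
        exact mul_le_mul_of_nonneg_right (by linarith) dist_nonneg
    _ = (K + 1) * ∑ i ∈ Finset.range E.1, dist (f (E.2 i).1) (f (E.2 i).2) := by
        rw [Finset.mul_sum]
    _ < (K + 1) * (ε / (K + 1)) := by gcongr
    _ = ε := by field_simp

/-- Chain rule estimate: the increments of `g(|ψ|²)` along an edge are controlled by the integral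
of `2 |g'(|ψ|²)| |ψ| |ψ'|`. -/
theorem abs_sub_le_integral {v : L2Edge} {a : ℂ} {g g' : ℝ → ℝ} {K : NNReal} {k : ℝ → ℝ}
    (hg : ∀ n, HasDerivAt g (g' n) n) (hK : LipschitzOnWith K g (Ici 0))
    (hki : Integrable k halfLine)
    (hk : ∀ᵐ x ∂halfLine, 2 * |g' (‖primitive a v x‖ ^ 2)| * (‖primitive a v x‖ * ‖v x‖) ≤ k x)
    {x y : ℝ} (hx : 0 ≤ x) (hxy : x ≤ y) :
    |g (‖primitive a v y‖ ^ 2) - g (‖primitive a v x‖ ^ 2)| ≤ ∫ t in x..y, k t := by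
  have hy := hx.trans hxy
  set p : ℝ → ℝ := fun x => a.re + ∫ t in (0 : ℝ)..x, (v t).re with hp
  set q : ℝ → ℝ := fun x => a.im + ∫ t in (0 : ℝ)..x, (v t).im with hq
  have hN : ∀ x, ‖primitive a v x‖ ^ 2 = p x * p x + q x * q x := by
    intro x
    rw [Complex.sq_norm, Complex.normSq_apply]; rfl
  have acp : AbsolutelyContinuousOnInterval p 0 y :=
    absolutelyContinuousOnInterval_primitive (locallyIntegrable_re v) a.re hy
  have acq : AbsolutelyContinuousOnInterval q 0 y :=
    absolutelyContinuousOnInterval_primitive (locallyIntegrable_im v) a.im hy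
  have acN : AbsolutelyContinuousOnInterval (fun x => p x * p x + q x * q x) 0 y :=
    (acp.fun_mul acp).fun_add (acq.fun_mul acq)
  have acF := (absolutelyContinuousOnInterval_comp acN (s := Ici 0)
    (fun t _ => mem_Ici.2 (add_nonneg (mul_self_nonneg _) (mul_self_nonneg _))) hK).mono (c := x) (d := y) (by
      rw [uIcc_of_le hxy, uIcc_of_le hy]; exact Icc_subset_Icc_left hx)
  rw [hN, hN, ← acF.integral_deriv_eq_sub, ← Real.norm_eq_abs]
  refine intervalIntegral.norm_integral_le_of_norm_le hxy ?_ ?_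
  · have hk' := (ae_restrict_iff' measurableSet_Ioi).1 hk
    filter_upwards [ae_hasDerivAt_primitive (locallyIntegrable_re v) a.re hy,
      ae_hasDerivAt_primitive (locallyIntegrable_im v) a.im hy, hk'] with t h1 h2 h3 ht
    have htm : t ∈ uIcc 0 y := by
      rw [uIcc_of_le hy]; exact ⟨hx.trans ht.1.le, ht.2⟩
    have d1 : HasDerivAt p (v t).re t := h1 htm
    have d2 : HasDerivAt q (v t).im t := h2 htm
    have d3 := (hg (p t * p t + q t * q t)).comp t ((d1.mul d1).add (d2.mul d2))
    refine le_trans (b := |g' (‖primitive a v t‖ ^ 2)| * |2 * (p t * (v t).re + q t * (v t).im)|)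
      (le_of_eq ?_) (le_trans ?_ (h3 (hx.trans_lt ht.1)))
    · rw [← abs_mul, Real.norm_eq_abs, hN]
      congr 1
      rw [show deriv (fun x => g (p x * p x + q x * q x)) t = _ from d3.deriv]
      ring
    · rw [abs_mul, abs_two]
      -- Cauchy–Schwarz in the plane; the square supplied to `nlinarith` is the defect in Lagrange's
      -- identity.
      have h4 : |p t * (v t).re + q t * (v t).im| ≤ ‖primitive a v t‖ * ‖v t‖ := by
        refine abs_le_of_sq_le_sq ?_ (by positivity)
        rw [mul_pow, hN, Complex.sq_norm, Complex.normSq_apply]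
        nlinarith [sq_nonneg (p t * (v t).im - q t * (v t).re)]
      have := abs_nonneg (g' (‖primitive a v t‖ ^ 2))
      nlinarith
  · rw [intervalIntegrable_iff, uIoc_of_le hxy]
    exact IntegrableOn.mono_set hki (fun t ht => hx.trans_lt ht.1)

theorem integrable_norm_mul_norm (u v : L2Edge) :
    Integrable (fun x => ‖u x‖ * ‖v x‖) halfLine :=
  (Lp.memLp u).norm.integrable_mul (Lp.memLp v).norm

theorem integrable_norm_sq (u : L2Edge) : Integrable (fun x => ‖u x‖ ^ 2) halfLine :=
  (Lp.memLp u).integrable_norm_pow (by norm_num)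

theorem norm_sq_eq_integral (u : L2Edge) : ‖u‖ ^ 2 = ∫ x, ‖u x‖ ^ 2 ∂halfLine := by
  have h := MeasureTheory.L2.inner_def (𝕜 := ℂ) u u
  rw [inner_self_eq_norm_sq_to_K] at h
  simp only [inner_self_eq_norm_sq_to_K] at h
  have h2 : ∀ x, ((‖u x‖ : ℂ)) ^ 2 = ((‖u x‖ ^ 2 : ℝ) : ℂ) := fun x => by push_cast; rfl
  simp only [RCLike.ofReal_eq_complex_ofReal, h2] at h
  rw [integral_complex_ofReal] at h
  exact_mod_cast h

/-- The derivative of `|ψ|²` is at most `2|ψ||ψ'|`, which is integrable as a product of two `L²`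
functions. -/
theorem bounded_primitive {u v : L2Edge} {a : ℂ} (hu : u =ᵐ[halfLine] primitive a v) :
    ∃ C, ∀ x, 0 ≤ x → ‖primitive a v x‖ ^ 2 ≤ C := by
  refine ⟨‖a‖ ^ 2 + ∫ t, 2 * (‖u t‖ * ‖v t‖) ∂halfLine, fun x hx => ?_⟩
  have hi := (integrable_norm_mul_norm u v).const_mul 2
  have h := abs_sub_le_integral (v := v) (a := a) (g := id) (g' := fun _ => 1) (K := 1)
    (fun n => hasDerivAt_id n) LipschitzWith.id.lipschitzOnWith hi (by
      filter_upwards [hu] with t ht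
      rw [ht]; simp) le_rfl hx
  have h2 : ∫ t in (0 : ℝ)..x, 2 * (‖u t‖ * ‖v t‖) ≤ ∫ t, 2 * (‖u t‖ * ‖v t‖) ∂halfLine := by
    rw [intervalIntegral.integral_of_le hx]
    exact setIntegral_mono_set hi (Filter.Eventually.of_forall fun t => by positivity)
      (Ioc_subset_Ioi_self).eventuallyLE
  rw [primitive_zero] at h
  have := (abs_le.1 h).2
  simp only [id] at this
  linarith

/-- An `L²` function comes arbitrarily close to zero arbitrarily far out. -/
theorem exists_norm_sq_lt {u : L2Edge} {f : ℝ → ℂ} (hu : u =ᵐ[halfLine] f) {x ε : ℝ} (hx : 0 ≤ x)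
    (hε : 0 < ε) : ∃ y, x ≤ y ∧ ‖f y‖ ^ 2 < ε := by
  by_contra! hcon
  have h1 : Integrable (fun t => ‖f t‖ ^ 2) halfLine :=
    (integrable_norm_sq u).congr (by filter_upwards [hu] with t ht; rw [ht])
  have h2 : IntegrableOn (fun t => ‖f t‖ ^ 2) (Ioi x) :=
    IntegrableOn.mono_set h1 (Ioi_subset_Ioi hx)
  have h3 : IntegrableOn (fun _ : ℝ => ε) (Ioi x) := by
    refine Integrable.mono' h2 aestronglyMeasurable_const ?_
    filter_upwards [ae_restrict_mem measurableSet_Ioi] with t ht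
    rw [Real.norm_of_nonneg hε.le]
    exact hcon t (mem_Ioi.1 ht).le
  rw [integrableOn_const_iff] at h3
  simp [hε.ne'] at h3

/-! ### The weight and the action of an edge -/

/-- The optimal weight: the square root of `κ |z|² - |z|⁴ / 2`. -/
noncomputable def weight (κ : ℝ) (z : ℂ) : ℝ := ‖z‖ * √(κ - ‖z‖ ^ 2 / 2)

theorem weight_nonneg (κ : ℝ) (z : ℂ) : 0 ≤ weight κ z := by unfold weight; positivity

theorem weight_le (κ : ℝ) (z : ℂ) : weight κ z ≤ √κ * ‖z‖ := by
  rw [weight, mul_comm]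
  exact mul_le_mul_of_nonneg_right (Real.sqrt_le_sqrt (by nlinarith [norm_nonneg z]))
    (norm_nonneg z)

theorem continuous_weight (κ : ℝ) : Continuous (weight κ) := by unfold weight; fun_prop

theorem weight_sq {κ : ℝ} {z : ℂ} (h : ‖z‖ ^ 2 ≤ 2 * κ) :
    weight κ z ^ 2 = κ * ‖z‖ ^ 2 - ‖z‖ ^ 4 / 2 := by
  rw [weight, mul_pow, Real.sq_sqrt (by linarith)]; ring

theorem integrable_weight_mul (κ : ℝ) (u v : L2Edge) :
    Integrable (fun x => weight κ (u x) * ‖v x‖) halfLine := by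
  refine ((integrable_norm_mul_norm u v).const_mul √κ).mono' ?_ ?_
  · exact ((continuous_weight κ).comp_aestronglyMeasurable (Lp.aestronglyMeasurable u)).mul
      (Lp.aestronglyMeasurable v).norm
  · refine Filter.Eventually.of_forall fun x => ?_
    rw [Real.norm_of_nonneg (mul_nonneg (weight_nonneg _ _) (norm_nonneg _)), ← mul_assoc]
    exact mul_le_mul_of_nonneg_right (weight_le _ _) (norm_nonneg _)

theorem lipschitzOnWith_potential {κ : ℝ} :
    LipschitzOnWith (Real.toNNReal (1 / 2 * √κ)) (potential κ) (Ici 0) := by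
  refine (convex_Ici 0).lipschitzOnWith_of_nnnorm_hasDerivWithin_le
    (fun n _ => (hasDerivAt_potential κ n).hasDerivWithinAt) fun n hn => ?_
  rw [← NNReal.coe_le_coe, coe_nnnorm, Real.coe_toNNReal _ (by positivity),
    Real.norm_of_nonneg (by positivity)]
  have : √(κ - n / 2) ≤ √κ := Real.sqrt_le_sqrt (by linarith [mem_Ici.1 hn])
  linarith

/-- The variation of the potential along an edge. -/
theorem two_mul_potential_le {u v : L2Edge} {a : ℂ} (hu : u =ᵐ[halfLine] primitive a v) (κ : ℝ)
    {x : ℝ} (hx : 0 ≤ x) :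
    |potential κ (‖primitive a v x‖ ^ 2) - potential κ (‖a‖ ^ 2)|
      + potential κ (‖primitive a v x‖ ^ 2) ≤ ∫ t, weight κ (u t) * ‖v t‖ ∂halfLine := by
  set k : ℝ → ℝ := fun t => weight κ (u t) * ‖v t‖ with hk
  have hki : Integrable k halfLine := integrable_weight_mul κ u v
  have hk0 : ∀ t, 0 ≤ k t := fun t => mul_nonneg (weight_nonneg _ _) (norm_nonneg _)
  have hbd : ∀ᵐ t ∂halfLine, 2 * |1 / 2 * √(κ - ‖primitive a v t‖ ^ 2 / 2)| *
      (‖primitive a v t‖ * ‖v t‖) ≤ k t := by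
    filter_upwards [hu] with t ht
    rw [abs_of_nonneg (by positivity)]
    simp only [hk, ht, weight]
    exact le_of_eq (by ring)
  refine le_of_forall_pos_le_add fun ε hε => ?_
  obtain ⟨δ, hδ, hlt⟩ := Metric.continuous_iff.1 (continuous_potential κ) 0 ε hε
  -- The path runs from the vertex to `x`, then on to a point `y` where the potential is below `ε`;
  -- the two increments add up.
  obtain ⟨y, hxy, hy⟩ := exists_norm_sq_lt hu hx hδ
  have e1 := abs_sub_le_integral (fun n => hasDerivAt_potential κ n) lipschitzOnWith_potential
    hki hbd le_rfl hx
  have e2 := abs_sub_le_integral (fun n => hasDerivAt_potential κ n) lipschitzOnWith_potential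
    hki hbd hx hxy
  have e3 := hlt (‖primitive a v y‖ ^ 2) (by
    rw [Real.dist_eq, sub_zero, abs_of_nonneg (by positivity)]; exact hy)
  rw [potential_zero, Real.dist_eq, sub_zero] at e3
  rw [primitive_zero] at e1
  have ii : ∀ {s t : ℝ}, 0 ≤ s → s ≤ t → IntervalIntegrable k volume s t := fun {s t} hs hst => by
    rw [intervalIntegrable_iff, uIoc_of_le hst]
    exact IntegrableOn.mono_set hki (fun r hr => hs.trans_lt hr.1)
  have e4 : (∫ t in (0 : ℝ)..x, k t) + ∫ t in x..y, k t ≤ ∫ t, k t ∂halfLine := by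
    rw [intervalIntegral.integral_add_adjacent_intervals (ii le_rfl hx) (ii hx hxy),
      intervalIntegral.integral_of_le (hx.trans hxy)]
    exact setIntegral_mono_set hki (Filter.Eventually.of_forall hk0)
      (Ioc_subset_Ioi_self).eventuallyLE
  have e5 := (abs_le.1 e2).1
  have e6 := (abs_lt.1 e3).2
  linarith

/-- Completing the square in the action of an edge. -/
theorem edge_action_eq {u v : L2Edge} {κ : ℝ} (hκ : ∀ᵐ x ∂halfLine, ‖u x‖ ^ 2 ≤ 2 * κ) :
    (1 / 2) * ‖v‖ ^ 2 - (1 / 4) * (∫ x, ‖u x‖ ^ 4 ∂halfLine) + κ / 2 * ‖u‖ ^ 2 =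
      (1 / 2) * (∫ x, (‖v x‖ - weight κ (u x)) ^ 2 ∂halfLine) +
        ∫ x, weight κ (u x) * ‖v x‖ ∂halfLine ∧
    Integrable (fun x => (‖v x‖ - weight κ (u x)) ^ 2) halfLine := by
  have i2 := integrable_norm_sq u
  have iv := integrable_norm_sq v
  have iw := integrable_weight_mul κ u v
  -- The bound on `|ψ|²` gives `|ψ|⁴ ≤ 2κ|ψ|²`.
  have i4 : Integrable (fun x => ‖u x‖ ^ 4) halfLine := by
    refine (i2.const_mul (2 * κ)).mono' ((Lp.aestronglyMeasurable u).norm.pow 4) ?_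
    filter_upwards [hκ] with x hx
    rw [Real.norm_of_nonneg (by positivity)]
    nlinarith [sq_nonneg ‖u x‖]
  have e : (fun x => ‖v x‖ ^ 2 + (κ * ‖u x‖ ^ 2 - 1 / 2 * ‖u x‖ ^ 4)
      - 2 * (weight κ (u x) * ‖v x‖)) =ᵐ[halfLine] fun x => (‖v x‖ - weight κ (u x)) ^ 2 := by
    filter_upwards [hκ] with x hx
    rw [sub_sq, weight_sq hx]; ring
  have ib : Integrable (fun x => κ * ‖u x‖ ^ 2 - 1 / 2 * ‖u x‖ ^ 4) halfLine :=
    (i2.const_mul κ).sub (i4.const_mul (1 / 2))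
  have ic : Integrable (fun x => ‖v x‖ ^ 2 + (κ * ‖u x‖ ^ 2 - 1 / 2 * ‖u x‖ ^ 4)) halfLine :=
    iv.add ib
  refine ⟨?_, (ic.sub (iw.const_mul 2)).congr e⟩
  rw [← integral_congr_ae e, norm_sq_eq_integral, norm_sq_eq_integral,
    integral_sub ic (iw.const_mul 2), integral_add iv ib,
    integral_sub (i2.const_mul κ) (i4.const_mul (1 / 2)), integral_const_mul, integral_const_mul,
    integral_const_mul]
  ring

/-! ### The strict lower bound -/

/-- A function on an edge that vanishes at the vertex and satisfies `|ψ'| ≤ C |ψ|` is zero. -/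
theorem eq_zero_of_norm_weakDeriv_le {u v : L2Edge} (hu : u =ᵐ[halfLine] primitive 0 v) {C : ℝ}
    (hC : ∀ᵐ x ∂halfLine, ‖v x‖ ≤ C * ‖u x‖) : u = 0 := by
  set N : ℝ → ℝ := fun x => ‖primitive 0 v x‖ ^ 2 with hN
  have hNc : ContinuousOn N (Ici 0) := (continuousOn_complex_primitive 0 v).norm.pow 2
  have hNi : Integrable N halfLine :=
    (integrable_norm_sq u).congr (by filter_upwards [hu] with t ht; rw [ht])
  have key : ∀ x, 0 ≤ x → N x ≤ 2 * C * ∫ t in (0 : ℝ)..x, N t := by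
    intro x hx
    have h := abs_sub_le_integral (v := v) (a := 0) (g := id) (g' := fun _ => 1) (K := 1)
      (fun n => hasDerivAt_id n) LipschitzWith.id.lipschitzOnWith (hNi.const_mul (2 * C)) (by
        filter_upwards [hu, hC] with t ht hc
        rw [ht] at hc
        simp only [abs_one, mul_one, hN]
        nlinarith [norm_nonneg (primitive 0 v t)]) le_rfl hx
    rw [primitive_zero, intervalIntegral.integral_const_mul] at h
    have := (abs_le.1 h).2
    simpa using this
  have hI : ∀ b, 0 ≤ b → ∫ t in (0 : ℝ)..b, N t = 0 := by
    intro b hb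
    have hcont : ContinuousOn (fun x => ∫ t in (0 : ℝ)..x, N t) (Icc 0 b) := by
      have := intervalIntegral.continuousOn_primitive_interval (a := 0) (b := b) (f := N)
        (μ := volume) (by
          rw [uIcc_of_le hb]
          exact (hNc.mono Icc_subset_Ici_self).integrableOn_compact isCompact_Icc)
      rwa [uIcc_of_le hb] at this
    have hder : ∀ x ∈ Ico 0 b, HasDerivWithinAt (fun x => ∫ t in (0 : ℝ)..x, N t) (N x)
        (Ici x) x := by
      intro x hx
      refine intervalIntegral.integral_hasDerivWithinAt_right (t := Ioi x) ?_ ?_ ?_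
      · exact (hNc.mono (by rw [uIcc_of_le hx.1]; exact Icc_subset_Ici_self)).intervalIntegrable
      · exact ((hNc.mono (fun t ht => hx.1.trans (mem_Ioi.1 ht).le)).stronglyMeasurableAtFilter_nhdsWithin
          measurableSet_Ioi x)
      · exact (hNc x hx.1).mono (fun t ht => hx.1.trans (mem_Ioi.1 ht).le)
    have hnn : ∀ x, 0 ≤ x → 0 ≤ ∫ t in (0 : ℝ)..x, N t := fun x hx =>
      intervalIntegral.integral_nonneg hx fun t _ => by positivity
    -- Gronwall is applied to the primitive of `N`, which starts at `0` and whose derivative `N` is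
    -- at most `2 * C` times itself.
    have hg := norm_le_gronwallBound_of_norm_deriv_right_le (δ := 0) (K := 2 * C) (ε := 0) hcont
      hder (by simp) (fun x hx => by
        rw [Real.norm_of_nonneg (by positivity), Real.norm_of_nonneg (hnn x hx.1), add_zero]
        exact key x hx.1) b ⟨hb, le_rfl⟩
    rw [gronwallBound_ε0, zero_mul] at hg
    exact norm_le_zero_iff.1 hg
  refine Lp.eq_zero_iff_ae_eq_zero.2 ?_
  filter_upwards [hu, ae_restrict_mem measurableSet_Ioi] with x hx hm
  have h1 := key x (mem_Ioi.1 hm).le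
  rw [hI x (mem_Ioi.1 hm).le, mul_zero] at h1
  rw [hx]
  have : ‖primitive 0 v x‖ ^ 2 = 0 := le_antisymm h1 (by positivity)
  simpa using this

/-- The energy of every admissible state lies strictly above the energy of the soliton of the same
mass on the line. -/
theorem lt_energy {M : ℝ} (hM : 0 < M) {Ψ : L2Graph} (hΨ : Ψ ∈ massSphere M) :
    -(M ^ 3) / 96 < energy Ψ := by
  obtain ⟨⟨hH, a, ha⟩, hnorm⟩ := hΨ
  choose v hv using hH
  have hu : ∀ i, Ψ i =ᵐ[halfLine] primitive a (v i) := fun i => (hv i).ae_eq_primitive (ha i)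
  have hmass : ∑ i, ‖Ψ i‖ ^ 2 = M := by rw [← hnorm, PiLp.norm_sq_eq_of_L2]
  set T : Set ℝ := {n | ∃ i, ∃ x, 0 ≤ x ∧ n = ‖primitive a (v i) x‖ ^ 2} with hT
  have hbdd : BddAbove T := by
    choose C hC using fun i => bounded_primitive (hu i)
    refine ⟨∑ i, |C i|, ?_⟩
    rintro n ⟨i, x, hx, rfl⟩
    exact ((hC i x hx).trans (le_abs_self _)).trans
      (Finset.single_le_sum (f := fun i => |C i|) (fun j _ => abs_nonneg _) (Finset.mem_univ i))
  have hne : T.Nonempty := ⟨_, 0, 0, le_rfl, rfl⟩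
  have hlub := isLUB_csSup hne hbdd
  -- With this choice `κ - |ψ|²/2` is nonnegative on the whole graph and vanishes in the limit along
  -- a maximizing sequence.
  set κ := sSup T / 2 with hκ
  have hS : sSup T = 2 * κ := by rw [hκ]; ring
  rw [hS] at hlub
  have hle : ∀ i x, 0 ≤ x → ‖primitive a (v i) x‖ ^ 2 ≤ 2 * κ := fun i x hx =>
    hlub.1 ⟨i, x, hx, rfl⟩
  have hκ0 : 0 ≤ κ := by
    have := (sq_nonneg _).trans (hle 0 0 le_rfl)
    linarith
  have ha0 : ‖a‖ ^ 2 ≤ 2 * κ := by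
    have := hle 0 0 le_rfl
    rwa [primitive_zero] at this
  have hae : ∀ i, ∀ᵐ x ∂halfLine, ‖Ψ i x‖ ^ 2 ≤ 2 * κ := fun i => by
    filter_upwards [hu i, ae_restrict_mem measurableSet_Ioi] with x hx hm
    rw [hx]; exact hle i x (mem_Ioi.1 hm).le
  set A : Fin 3 → ℝ := fun i => ∫ t, weight κ (Ψ i t) * ‖v i t‖ ∂halfLine with hA
  set D : Fin 3 → ℝ := fun i => ∫ t, (‖v i t‖ - weight κ (Ψ i t)) ^ 2 ∂halfLine with hD
  have hD0 : ∀ i, 0 ≤ D i := fun i => integral_nonneg fun t => sq_nonneg _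
  have hvert : ∀ i, potential κ (‖a‖ ^ 2) ≤ A i := fun i => by
    have := two_mul_potential_le (hu i) κ le_rfl
    rw [primitive_zero, sub_self, abs_zero, zero_add] at this
    exact this
  -- The edge carrying `n` yields `2P(n) - P(|a|²)`; the other two yield `P(|a|²)` each.
  have hpt : ∀ n ∈ T, 2 * potential κ n + potential κ (‖a‖ ^ 2) ≤ ∑ i, A i := by
    rintro n ⟨i, x, hx, rfl⟩
    have h1 := two_mul_potential_le (hu i) κ hx
    have h2 := le_abs_self (potential κ (‖primitive a (v i) x‖ ^ 2) - potential κ (‖a‖ ^ 2))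
    have h0 := hvert 0
    have h1' := hvert 1
    have h2' := hvert 2
    rw [Fin.sum_univ_three]
    change _ ≤ A i at h1
    fin_cases i <;> simp only [Fin.zero_eta, Fin.mk_one, Fin.reduceFinMk] at * <;> linarith
  have hclosed : IsClosed {n | 2 * potential κ n + potential κ (‖a‖ ^ 2) ≤ ∑ i, A i} :=
    isClosed_le (((continuous_potential κ).const_mul 2).add continuous_const) continuous_const
  -- A closed condition passes to the supremum, with no need for it to be attained.
  have hsup : 2 * potential κ (2 * κ) + potential κ (‖a‖ ^ 2) ≤ ∑ i, A i :=
    closure_minimal hpt hclosed (hlub.mem_closure hne)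
  rw [potential_two_mul] at hsup
  have henergy : energy Ψ + κ / 2 * M = 1 / 2 * ∑ i, D i + ∑ i, A i := by
    rw [energy, ← hmass, Finset.mul_sum, Finset.mul_sum, ← Finset.sum_add_distrib,
      ← Finset.sum_add_distrib]
    refine Finset.sum_congr rfl fun i _ => ?_
    rw [(hv i).weakDeriv_eq]
    exact (edge_action_eq (hae i)).1
  have hpoly : -(M ^ 3) / 96 ≤ 4 / 3 * (κ * √κ) - κ / 2 * M := by
    have h1 := Real.sq_sqrt hκ0
    set t := √κ with ht
    have ht0 : 0 ≤ t := Real.sqrt_nonneg _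
    -- This product is exactly `4/3 t³ - M t²/2 + M³/96`, with a double root at the minimizer.
    have h2 : 0 ≤ (t - M / 4) ^ 2 * (4 / 3 * (t + M / 8)) := by positivity
    rw [← h1]
    nlinarith
  have hpa : 0 ≤ potential κ (‖a‖ ^ 2) := potential_nonneg (by positivity) ha0
  have hDs : 0 ≤ ∑ i, D i := Finset.sum_nonneg fun i _ => hD0 i
  refine lt_of_le_of_ne (by linarith) fun heq => ?_
  -- Equality of the energies makes every nonnegative term discarded in the lower bound vanish.
  have hpa0 : potential κ (‖a‖ ^ 2) = 0 := by linarith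
  have hDs0 : ∑ i, D i = 0 := by linarith
  have ha' : a = 0 := by
    by_contra hne
    have := potential_pos (by positivity) ha0
    linarith
  subst ha'
  have hzero : ∀ i, Ψ i = 0 := by
    intro i
    refine eq_zero_of_norm_weakDeriv_le (C := √κ) (hu i) ?_
    have hDi : D i = 0 := (Finset.sum_eq_zero_iff_of_nonneg fun i _ => hD0 i).1 hDs0 i
      (Finset.mem_univ i)
    have := (integral_eq_zero_iff_of_nonneg (fun t => sq_nonneg _)
      (edge_action_eq (v := v i) (hae i)).2).1 hDi
    filter_upwards [this] with x hx
    have hx' : ‖v i x‖ - weight κ (Ψ i x) = 0 := by simpa using hx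
    rw [sub_eq_zero.1 hx']
    exact weight_le _ _
  rw [← hmass] at hM
  simp [hzero] at hM

/-! ### Solitons on a half-line and their integrals -/

theorem hasDerivAt_tanh (x : ℝ) : HasDerivAt Real.tanh (1 - Real.tanh x ^ 2) x := by
  have h := (Real.hasDerivAt_sinh x).fun_div (Real.hasDerivAt_cosh x) (Real.cosh_pos x).ne'
  have e : Real.tanh = fun x => Real.sinh x / Real.cosh x :=
    funext fun x => Real.tanh_eq_sinh_div_cosh x
  rw [e]
  refine h.congr_deriv ?_
  have := (Real.cosh_pos x).ne'
  field_simp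

theorem tendsto_tanh_atTop : Filter.Tendsto Real.tanh Filter.atTop (nhds 1) := by
  have e : Real.tanh = fun x => (1 - Real.exp (-(2 * x))) / (1 + Real.exp (-(2 * x))) := by
    funext x
    have h1 : Real.exp (-(2 * x)) = Real.exp (-x) * Real.exp (-x) := by
      rw [← Real.exp_add]; congr 1; ring
    have h2 : Real.exp x * Real.exp (-x) = 1 := by rw [← Real.exp_add]; simp
    rw [Real.tanh_eq, h1, div_eq_div_iff (by positivity) (by positivity)]
    linear_combination (2 * Real.exp (-x)) * h2
  have h : Filter.Tendsto (fun x : ℝ => Real.exp (-(2 * x))) Filter.atTop (nhds 0) :=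
    Real.tendsto_exp_neg_atTop_nhds_zero.comp
      (Filter.tendsto_id.const_mul_atTop (by norm_num : (0 : ℝ) < 2))
  rw [e]
  have h' := (h.const_sub 1).div (h.const_add 1) (by norm_num)
  rwa [sub_zero, add_zero, div_one] at h'

/-- The soliton `√2 B sech (B (t - c))`. -/
noncomputable def soliton (B c t : ℝ) : ℝ := √2 * B * (Real.cosh (B * (t - c)))⁻¹

theorem hasDerivAt_tanh_affine (B c t : ℝ) :
    HasDerivAt (fun t => Real.tanh (B * (t - c))) (B * (1 - Real.tanh (B * (t - c)) ^ 2)) t := by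
  have h : HasDerivAt (fun t => B * (t - c)) B t := by
    simpa using ((hasDerivAt_id t).sub_const c).const_mul B
  exact ((hasDerivAt_tanh _).comp t h).congr_deriv (by ring)

theorem hasDerivAt_soliton (B c t : ℝ) :
    HasDerivAt (soliton B c) (-(B * Real.tanh (B * (t - c)) * soliton B c t)) t := by
  have h : HasDerivAt (fun t => B * (t - c)) B t := by
    simpa using ((hasDerivAt_id t).sub_const c).const_mul B
  have hc := (Real.cosh_pos (B * (t - c))).ne'
  refine ((((Real.hasDerivAt_cosh _).comp t h).fun_inv hc).const_mul (√2 * B)).congr_deriv ?_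
  rw [soliton, Real.tanh_eq_sinh_div_cosh]
  simp only [Function.comp]
  field_simp

/-- Writing `sech² = 1 - tanh²` turns the mass, kinetic and quartic densities into polynomials in
`tanh` times its derivative, which `integral_comp_tanh` integrates. -/
theorem soliton_sq (B c t : ℝ) :
    soliton B c t ^ 2 = 2 * B ^ 2 * (1 - Real.tanh (B * (t - c)) ^ 2) := by
  have hc := (Real.cosh_pos (B * (t - c))).ne'
  rw [soliton, mul_pow, mul_pow, Real.sq_sqrt zero_le_two, Real.tanh_eq_sinh_div_cosh]
  field_simp
  linear_combination (-B ^ 2) * Real.cosh_sq_sub_sinh_sq (B * (t - c))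

theorem continuous_soliton (B c : ℝ) : Continuous (soliton B c) :=
  continuous_iff_continuousAt.2 fun t => (hasDerivAt_soliton B c t).continuousAt

theorem continuous_tanh_affine (B c : ℝ) : Continuous fun t => Real.tanh (B * (t - c)) :=
  continuous_iff_continuousAt.2 fun t => (hasDerivAt_tanh_affine B c t).continuousAt

/-- Integrals over the half-line of `F'(tanh) sech²`. -/
theorem integral_comp_tanh {B : ℝ} (hB : 0 < B) (c : ℝ) {F F' : ℝ → ℝ}
    (hF : ∀ y, HasDerivAt F (F' y) y) (hF' : ∀ y, 0 ≤ F' y) :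
    Integrable (fun t => F' (Real.tanh (B * (t - c))) * (1 - Real.tanh (B * (t - c)) ^ 2))
      halfLine ∧
    ∫ t, F' (Real.tanh (B * (t - c))) * (1 - Real.tanh (B * (t - c)) ^ 2) ∂halfLine =
      (F 1 - F (Real.tanh (B * (0 - c)))) / B := by
  have hd : ∀ t ∈ Ici (0 : ℝ), HasDerivAt (fun t => F (Real.tanh (B * (t - c))) / B)
      (F' (Real.tanh (B * (t - c))) * (1 - Real.tanh (B * (t - c)) ^ 2)) t := by
    intro t _
    refine (((hF _).comp t (hasDerivAt_tanh_affine B c t)).div_const B).congr_deriv ?_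
    field_simp
  have hpos : ∀ t ∈ Ioi (0 : ℝ),
      0 ≤ F' (Real.tanh (B * (t - c))) * (1 - Real.tanh (B * (t - c)) ^ 2) := fun t _ =>
    mul_nonneg (hF' _) (by linarith [Real.tanh_sq_lt_one (B * (t - c))])
  have hlim : Filter.Tendsto (fun t => F (Real.tanh (B * (t - c))) / B) Filter.atTop
      (nhds (F 1 / B)) := by
    refine Filter.Tendsto.div_const ?_ B
    refine (hF 1).continuousAt.tendsto.comp (tendsto_tanh_atTop.comp ?_)
    exact (Filter.tendsto_atTop_add_const_right _ (-c) Filter.tendsto_id).const_mul_atTop hB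
  -- A nonnegative derivative of a function with a finite limit is integrable; hence the sign
  -- condition on `F'`.
  refine ⟨integrableOn_Ioi_deriv_of_nonneg' hd hpos hlim, ?_⟩
  rw [integral_Ioi_of_hasDerivAt_of_nonneg' hd hpos hlim]
  ring

theorem integral_soliton_sq {B : ℝ} (hB : 0 < B) (c : ℝ) :
    Integrable (fun t => soliton B c t ^ 2) halfLine ∧
    ∫ t, soliton B c t ^ 2 ∂halfLine = 2 * B * (1 - Real.tanh (B * (0 - c))) := by
  obtain ⟨h1, h2⟩ := integral_comp_tanh hB c (F := fun y => y) (F' := fun _ => 1)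
    (fun y => hasDerivAt_id' y) (fun _ => zero_le_one)
  simp only [one_mul] at h1 h2
  simp only [soliton_sq]
  refine ⟨h1.const_mul _, ?_⟩
  rw [integral_const_mul, h2]
  field_simp

theorem integral_soliton_pow_four {B : ℝ} (hB : 0 < B) (c : ℝ) :
    ∫ t, soliton B c t ^ 4 ∂halfLine = 4 * B ^ 3 *
      (2 / 3 - Real.tanh (B * (0 - c)) + Real.tanh (B * (0 - c)) ^ 3 / 3) := by
  have h0 : ∀ t, soliton B c t ^ 4 = 4 * B ^ 4 * (1 - Real.tanh (B * (t - c)) ^ 2) -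
      4 * B ^ 4 * (Real.tanh (B * (t - c)) ^ 2 * (1 - Real.tanh (B * (t - c)) ^ 2)) := by
    intro t
    rw [show soliton B c t ^ 4 = (soliton B c t ^ 2) ^ 2 by ring, soliton_sq]; ring
  obtain ⟨h1, h2⟩ := integral_comp_tanh hB c (F := fun y => y) (F' := fun _ => 1)
    (fun y => hasDerivAt_id' y) (fun _ => zero_le_one)
  obtain ⟨h3, h4⟩ := integral_comp_tanh hB c (F := fun y => y ^ 3 / 3) (F' := fun y => y ^ 2)
    (fun y => ((hasDerivAt_pow 3 y).div_const 3).congr_deriv (by norm_num)) (fun y => sq_nonneg y)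
  simp only [one_mul] at h1 h2
  simp only [h0]
  rw [integral_sub (h1.const_mul _) (h3.const_mul _), integral_const_mul, integral_const_mul, h2,
    h4]
  field_simp
  ring

theorem integral_deriv_soliton_sq {B : ℝ} (hB : 0 < B) (c : ℝ) :
    Integrable (fun t => (-(B * Real.tanh (B * (t - c)) * soliton B c t)) ^ 2) halfLine ∧
    ∫ t, (-(B * Real.tanh (B * (t - c)) * soliton B c t)) ^ 2 ∂halfLine =
      2 / 3 * B ^ 3 * (1 - Real.tanh (B * (0 - c)) ^ 3) := by
  have h0 : ∀ t, (-(B * Real.tanh (B * (t - c)) * soliton B c t)) ^ 2 =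
      2 * B ^ 4 * (Real.tanh (B * (t - c)) ^ 2 * (1 - Real.tanh (B * (t - c)) ^ 2)) := by
    intro t
    rw [neg_sq, mul_pow, soliton_sq]; ring
  obtain ⟨h3, h4⟩ := integral_comp_tanh hB c (F := fun y => y ^ 3 / 3) (F' := fun y => y ^ 2)
    (fun y => ((hasDerivAt_pow 3 y).div_const 3).congr_deriv (by norm_num)) (fun y => sq_nonneg y)
  simp only [h0]
  refine ⟨h3.const_mul _, ?_⟩
  rw [integral_const_mul, h4]
  field_simp

theorem memLp_ofReal {f : ℝ → ℝ} (hf : Continuous f)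
    (h : Integrable (fun t => f t ^ 2) halfLine) :
    MemLp (fun t => (f t : ℂ)) 2 halfLine := by
  have hc : Continuous fun t => (f t : ℂ) := Complex.continuous_ofReal.comp hf
  rw [memLp_two_iff_integrable_sq_norm hc.aestronglyMeasurable]
  simpa using h

theorem memLp_soliton {B : ℝ} (hB : 0 < B) (c : ℝ) :
    MemLp (fun t => (soliton B c t : ℂ)) 2 halfLine :=
  memLp_ofReal (continuous_soliton B c) (integral_soliton_sq hB c).1

/-- On a half-line, the weak derivative of a differentiable function is its derivative. -/
theorem isWeakDeriv_of_hasDerivAt {u v : L2Edge} {f f' : ℝ → ℝ}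
    (hu : u =ᵐ[halfLine] fun t => (f t : ℂ)) (hv : v =ᵐ[halfLine] fun t => (f' t : ℂ))
    (hf : ∀ t, HasDerivAt f (f' t) t) (hf' : Continuous f') : IsWeakDeriv u v := by
  intro φ h1 h2 h3
  have hφ' : Continuous (deriv φ) := (contDiff_infty_iff_deriv.1 h1).2.continuous
  have hfc : Continuous f := continuous_iff_continuousAt.2 fun t => (hf t).continuousAt
  have off : ∀ x, x ∉ Ioi (0 : ℝ) → x ∉ tsupport φ := fun x hx hm => hx (h3 hm)
  have hd0 : ∀ x, x ∉ tsupport φ → deriv φ x = 0 := fun x hx =>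
    image_eq_zero_of_notMem_tsupport fun hm => hx (tsupport_deriv_subset hm)
  have ibp := integral_mul_deriv_eq_deriv_mul_of_integrable (u := f) (u' := f') (v := φ)
    (v' := deriv φ) (fun t _ => hf t)
    (fun t _ => ((contDiff_infty_iff_deriv.1 h1).1 t).hasDerivAt)
    ((hfc.mul hφ').integrable_of_hasCompactSupport h2.deriv.mul_left)
    ((hf'.mul h1.continuous).integrable_of_hasCompactSupport h2.mul_left)
    ((hfc.mul h1.continuous).integrable_of_hasCompactSupport h2.mul_left)
  have e1 : ∫ x, deriv φ x • u x ∂halfLine = ((∫ x, f x * deriv φ x : ℝ) : ℂ) := by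
    rw [← setIntegral_eq_integral_of_forall_compl_eq_zero (s := Ioi 0) (f := fun x => f x * deriv φ x)
      (fun x hx => by rw [hd0 x (off x hx), mul_zero]), ← integral_complex_ofReal]
    refine integral_congr_ae ?_
    filter_upwards [hu] with x hx
    rw [hx, Complex.real_smul]; push_cast; ring
  have e2 : ∫ x, φ x • v x ∂halfLine = ((∫ x, f' x * φ x : ℝ) : ℂ) := by
    rw [← setIntegral_eq_integral_of_forall_compl_eq_zero (s := Ioi 0) (f := fun x => f' x * φ x)
      (fun x hx => by rw [image_eq_zero_of_notMem_tsupport (off x hx), mul_zero]),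
      ← integral_complex_ofReal]
    refine integral_congr_ae ?_
    filter_upwards [hv] with x hx
    rw [hx, Complex.real_smul]; push_cast; ring
  rw [e1, e2, ibp]
  push_cast; rfl

/-- Mass, kinetic energy and potential energy of a soliton restricted to an edge. -/
theorem soliton_edge {B : ℝ} (hB : 0 < B) (c : ℝ) {u : L2Edge}
    (hu : u =ᵐ[halfLine] fun t => (soliton B c t : ℂ)) :
    u ∈ H1Edge ∧ HasVertexValue u (soliton B c 0) ∧
    ‖u‖ ^ 2 = 2 * B * (1 - Real.tanh (B * (0 - c))) ∧
    (1 / 2) * ‖weakDeriv u‖ ^ 2 - (1 / 4) * ∫ x, ‖u x‖ ^ 4 ∂halfLine =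
      B ^ 3 * (-(1 / 3) + Real.tanh (B * (0 - c)) - 2 / 3 * Real.tanh (B * (0 - c)) ^ 3) := by
  have hcont : Continuous fun t => -(B * Real.tanh (B * (t - c)) * soliton B c t) :=
    ((continuous_const.mul (continuous_tanh_affine B c)).mul (continuous_soliton B c)).neg
  obtain ⟨hd1, hd2⟩ := integral_deriv_soliton_sq hB c
  have hm := memLp_ofReal hcont hd1
  have hw : IsWeakDeriv u hm.toLp :=
    isWeakDeriv_of_hasDerivAt hu hm.coeFn_toLp (hasDerivAt_soliton B c) hcont
  refine ⟨⟨_, hw⟩, ⟨_, (Complex.continuous_ofReal.comp (continuous_soliton B c)).continuousOn,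
    hu, rfl⟩, ?_, ?_⟩
  · rw [norm_sq_eq_integral, ← (integral_soliton_sq hB c).2]
    refine integral_congr_ae ?_
    filter_upwards [hu] with x hx
    rw [hx]; simp
  · have e1 : ‖weakDeriv u‖ ^ 2 = 2 / 3 * B ^ 3 * (1 - Real.tanh (B * (0 - c)) ^ 3) := by
      rw [hw.weakDeriv_eq, norm_sq_eq_integral, ← hd2]
      refine integral_congr_ae ?_
      filter_upwards [hm.coeFn_toLp] with x hx
      rw [hx, Complex.norm_real, Real.norm_eq_abs, sq_abs]
    have e2 : ∫ x, ‖u x‖ ^ 4 ∂halfLine = 4 * B ^ 3 *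
        (2 / 3 - Real.tanh (B * (0 - c)) + Real.tanh (B * (0 - c)) ^ 3 / 3) := by
      rw [← integral_soliton_pow_four hB c]
      refine integral_congr_ae ?_
      filter_upwards [hu] with x hx
      rw [hx, Complex.norm_real, Real.norm_eq_abs, Even.pow_abs (by decide)]
    rw [e1, e2]; ring

/-! ### Sesquisolitons -/

theorem profile_eq_soliton (m₁ m₂ x : ℝ) :
    profile m₁ m₂ x = ![soliton (m₁ / 2) 0, soliton (m₂ / 4) x, soliton (m₂ / 4) (-x)] := by
  have h2 : √2 * √2 = 2 := Real.mul_self_sqrt zero_le_two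
  have e1 : m₁ / √2 = √2 * (m₁ / 2) := by
    field_simp; linear_combination (-m₁) * h2
  have e2 : m₂ / (2 * √2) = √2 * (m₂ / 4) := by
    field_simp; linear_combination (-2 * m₂) * h2
  unfold profile soliton
  rw [e1, e2]
  simp [sub_neg_eq_add]

/-- Admissibility, mass and energy of a sesquisoliton. -/
theorem IsSesquisoliton.energy_eq {m₁ m₂ x : ℝ} {Ψ : L2Graph} (h : IsSesquisoliton m₁ m₂ x Ψ) :
    Ψ ∈ energySpace ∧ ‖Ψ‖ ^ 2 = m₁ + m₂ ∧ energy Ψ = -(m₁ ^ 3) / 24 - m₂ ^ 3 / 96 := by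
  obtain ⟨h1, h12, hx, hcont, hΨ⟩ := h
  have h2 : 0 < m₂ := h1.trans_le h12
  rw [profile_eq_soliton] at hΨ
  obtain ⟨a1, a2, a3, a4⟩ := soliton_edge (by positivity : 0 < m₁ / 2) 0 (hΨ 0)
  obtain ⟨b1, b2, b3, b4⟩ := soliton_edge (by positivity : 0 < m₂ / 4) x (hΨ 1)
  obtain ⟨c1, c2, c3, c4⟩ := soliton_edge (by positivity : 0 < m₂ / 4) (-x) (hΨ 2)
  have v1 : soliton (m₂ / 4) x 0 = soliton (m₁ / 2) 0 0 := by
    rw [soliton, soliton, hcont]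
    simp only [zero_sub, mul_neg, Real.cosh_neg, neg_zero, mul_zero, Real.cosh_zero]
    ring
  have v2 : soliton (m₂ / 4) (-x) 0 = soliton (m₁ / 2) 0 0 := by
    rw [← v1, soliton, soliton]
    simp
  rw [v1] at b2
  rw [v2] at c2
  have t0 : Real.tanh (m₁ / 2 * (0 - 0)) = 0 := by simp
  -- The second and third edges have opposite centres, so the odd terms in `tanh` cancel in mass and
  -- energy.
  have t1 : Real.tanh (m₂ / 4 * (0 - -x)) = - Real.tanh (m₂ / 4 * (0 - x)) := by
    rw [← Real.tanh_neg]; congr 1; ring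
  rw [t0] at a3 a4
  rw [t1] at c3 c4
  refine ⟨⟨?_, soliton (m₁ / 2) 0 0, ?_⟩, ?_, ?_⟩
  · intro i; fin_cases i
    exacts [a1, b1, c1]
  · intro i; fin_cases i
    exacts [a2, b2, c2]
  · rw [PiLp.norm_sq_eq_of_L2, Fin.sum_univ_three, a3, b3, c3]; ring
  · rw [energy, Fin.sum_univ_three, a4, b4, c4]; ring

/-- Continuity at the vertex reads `cosh (m₂ x / 4) = m₂ / (2 m₁)`, solvable by `Real.arcosh` as
soon as the right side is at least one. -/
theorem exists_isSesquisoliton {m₁ m₂ : ℝ} (h1 : 0 < m₁) (h2 : 2 * m₁ ≤ m₂) :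
    ∃ x Ψ, IsSesquisoliton m₁ m₂ x Ψ := by
  have hm : 0 < m₂ := by linarith
  have hge : 1 ≤ m₂ / (2 * m₁) := by rw [le_div_iff₀ (by positivity)]; linarith
  set x := 4 / m₂ * Real.arcosh (m₂ / (2 * m₁)) with hx
  have hmem : ∀ i, MemLp (fun t => (profile m₁ m₂ x i t : ℂ)) 2 halfLine := by
    rw [profile_eq_soliton]
    intro i; fin_cases i
    exacts [memLp_soliton (by positivity) _, memLp_soliton (by positivity) _,
      memLp_soliton (by positivity) _]
  refine ⟨x, WithLp.toLp 2 fun i => (hmem i).toLp, h1, by linarith, ?_, ?_,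
    fun i => (hmem i).coeFn_toLp⟩
  · exact mul_nonneg (by positivity) (Real.arcosh_nonneg hge)
  · have : m₂ / 4 * x = Real.arcosh (m₂ / (2 * m₁)) := by rw [hx]; field_simp
    rw [this, Real.cosh_arcosh hge]
    field_simp

theorem sesquisolitons_subset_massSphere (M : ℝ) : sesquisolitons M ⊆ massSphere M := by
  rintro Ψ ⟨⟨m₁, m₂, x, h⟩, hM⟩
  exact ⟨h.energy_eq.1, hM⟩

/-- The energies of the sesquisolitons of mass `M` come arbitrarily close to that of the soliton
of mass `M` on the line. -/
theorem le_of_mem_lowerBounds_sesquisolitons {M b : ℝ} (hM : 0 < M)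
    (hb : b ∈ lowerBounds (energy '' sesquisolitons M)) : b ≤ -(M ^ 3) / 96 := by
  have hlim : Filter.Tendsto (fun m : ℝ => -(m ^ 3) / 24 - (M - m) ^ 3 / 96)
      (nhdsWithin 0 (Ioi 0)) (nhds (-(M ^ 3) / 96)) := by
    have hc : Continuous fun m : ℝ => -(m ^ 3) / 24 - (M - m) ^ 3 / 96 := by fun_prop
    have := hc.tendsto 0
    refine (this.mono_left nhdsWithin_le_nhds).trans (le_of_eq ?_)
    congr 1; ring
  refine ge_of_tendsto hlim ?_
  -- For `m < M / 3` one has `2 * m ≤ M - m`, so a sesquisoliton with masses `m` and `M - m` exists.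
  filter_upwards [Ioo_mem_nhdsGT (show (0 : ℝ) < M / 3 by positivity)] with m hm
  obtain ⟨x, Ψ, hΨ⟩ := exists_isSesquisoliton hm.1 (m₂ := M - m) (by linarith [hm.2])
  obtain ⟨-, e2, e3⟩ := hΨ.energy_eq
  rw [← e3]
  exact hb ⟨Ψ, ⟨⟨_, _, _, hΨ⟩, by rw [e2]; ring⟩, rfl⟩

end StarGraph

theorem theorem1 (M : ℝ) (hM : 0 < M) :
    IsGLB (StarGraph.energy '' StarGraph.massSphere M) (-(M ^ 3) / 96) ∧
    IsGLB (StarGraph.energy '' StarGraph.sesquisolitons M) (-(M ^ 3) / 96) ∧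
    ∀ Ψ ∈ StarGraph.massSphere M, -(M ^ 3) / 96 < StarGraph.energy Ψ := by
  have hlt : ∀ Ψ ∈ StarGraph.massSphere M, -(M ^ 3) / 96 < StarGraph.energy Ψ :=
    fun Ψ hΨ => StarGraph.lt_energy hM hΨ
  have hlow : -(M ^ 3) / 96 ∈ lowerBounds (StarGraph.energy '' StarGraph.massSphere M) := by
    rintro _ ⟨Ψ, hΨ, rfl⟩
    exact (hlt Ψ hΨ).le
  have hsub := image_mono (f := StarGraph.energy) (StarGraph.sesquisolitons_subset_massSphere M)
  refine ⟨⟨hlow, fun b hb => ?_⟩, ⟨lowerBounds_mono_set hsub hlow, fun b hb => ?_⟩, hlt⟩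
  · exact StarGraph.le_of_mem_lowerBounds_sesquisolitons hM (lowerBounds_mono_set hsub hb)
  · exact StarGraph.le_of_mem_lowerBounds_sesquisolitons hM hb
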